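/- Let $\mathbb{D}$ be the open unit disc in $\mathbb{C}$, let $H(\mathbb{D})$ be the space of analytic functions on $\mathbb{D}$, and let $dA$ be Lebesgue area measure on $\mathbb{D}$ normalized so that $A(\mathbb{D})=1$. For $f\in H(\mathbb{D})$ put $$\|f\|_{B_1}=|f(0)|+|f'(0)|+\int_{\mathbb{D}}|f''(z)|\,dA(z)\in[0,\infty],$$ and let $B_1=\{f\in H(\mathbb{D}):\|f\|_{B_1}<\infty\}$ (the analytic Besov space, also known as the minimal Möbius invariant space). For $g\in H(\mathbb{D})$ let $(T_gf)(z)=\int_0^z f(w)g'(w)\,dw$ for $f\in B_1$ and $z\in\mathbb{D}$, and let $\|T_g\|=\sup\{\|T_gf\|_{B_1}: f\in B_1,\ \|f\|_{B_1}\le 1\}\in[0,\infty]$. Then for every $g\in H(\mathbb{D})$ the operator $T_g$ is bounded on $B_1$ (that is, it maps $B_1$ into $B_1$ and there is a finite $C$ with $\|T_gf\|_{B_1}\le C\|f\|_{B_1}$ for all $f\in B_1$) if and only if $g\in B_1$. Moreover, $$\|g-g(0)\|_{B_1}\le\|T_g\|\le(1+\pi)\,\|g-g(0)\|_{B_1}.$$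 -/

import Mathlib

open MeasureTheory
open scoped ENNReal NNReal

noncomputable section

namespace Besov

/-- The open unit disc. Analytic functions on it are represented by functions `ℂ → ℂ` that are
complex differentiable on the disc; their values elsewhere play no role. -/
def disc : Set ℂ := Metric.ball 0 1

/-- Normalized Lebesgue area measure on the unit disc. -/
def areaMeasure : Measure ℂ := ENNReal.ofReal (Real.pi⁻¹) • (volume.restrict disc)

/-- `|f(0)| + |f'(0)| + ∫_D |f''| dA`, with value `∞` if the integral diverges. -/
def b1Norm (f : ℂ → ℂ) : ℝ≥0∞ :=
  ‖f 0‖ₑ + ‖deriv f 0‖ₑ + ∫⁻ z, ‖deriv (deriv f) z‖ₑ ∂areaMeasure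

/-- Membership in the analytic Besov space `B_1`. -/
def MemB1 (f : ℂ → ℂ) : Prop :=
  DifferentiableOn ℂ f disc ∧ b1Norm f < ∞

/-- The Volterra type operator `T_g f (z) = ∫_0^z f(w) g'(w) dw`, the integral being taken along
the segment `w = t z`, `0 ≤ t ≤ 1`. -/
def volterra (g f : ℂ → ℂ) (z : ℂ) : ℂ :=
  ∫ t in (0 : ℝ)..1, f (t * z) * deriv g (t * z) * z

/-- `T` maps `B_1` into itself, and is bounded there. -/
def BoundedOnB1 (T : (ℂ → ℂ) → (ℂ → ℂ)) : Prop :=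
  (∀ f, MemB1 f → MemB1 (T f)) ∧
    ∃ C : ℝ≥0, ∀ f, MemB1 f → b1Norm (T f) ≤ C * b1Norm f

/-- The operator norm on `B_1`: the supremum of `‖T f‖` over the closed unit ball of `B_1`. -/
def opNormB1 (T : (ℂ → ℂ) → (ℂ → ℂ)) : ℝ≥0∞ :=
  ⨆ (f : ℂ → ℂ) (_ : MemB1 f) (_ : b1Norm f ≤ 1), b1Norm (T f)

end Besov

end

open MeasureTheory
open scoped ENNReal NNReal Topology ComplexConjugate

namespace Besov

/-! Since `T_g f` vanishes at 0 and has derivative `f g'`, its norm is `|f(0) g'(0)| + ∫ |f' g' + f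
g''| dA`. Taking `f = 1` gives the norm of `g - g(0)`, hence the lower bound and the necessity of `g
∈ B_1`.

For the upper bound, the weight `1 - |w|^2` recovers `f` from `f''` with the kernel `z^2 / (1 - z
w̄)`. The weighted kernel is bounded by 2, so `f` is bounded by its norm data (`MemB1.enorm_le`),
which settles `f g''`. Differentiating the kernel in `z` gives `derivKernel`, which recovers `f'`.
It is unbounded, but its `L^2` norm in `z` is bounded uniformly in `w`
(`lintegral_derivKernel_sq_le`). Expressing both `f'` and `g'` through it, Tonelli reduces `∫ |f'
g'| dA` to integrals of products of two kernels (`lintegral_deriv_mul_deriv_le`). The two terms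
together cost a factor 4, and `4 ≤ 1 + π`. -/

/-! ### The disc and its normalized area measure. -/

theorem isOpen_disc : IsOpen disc := Metric.isOpen_ball

theorem mem_disc {z : ℂ} : z ∈ disc ↔ ‖z‖ < 1 := by simp [disc]

instance : IsFiniteMeasure areaMeasure := by
  have : IsFiniteMeasure (volume.restrict disc) :=
    ⟨by simp [disc]⟩
  unfold areaMeasure
  exact Measure.smul_finite _ ENNReal.ofReal_ne_top

theorem areaMeasure_univ : areaMeasure Set.univ = 1 := by
  have h : ENNReal.ofReal Real.pi⁻¹ * ENNReal.ofReal Real.pi = 1 := by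
    rw [← ENNReal.ofReal_mul (by positivity), inv_mul_cancel₀ Real.pi_ne_zero, ENNReal.ofReal_one]
  simp only [areaMeasure, Measure.smul_apply, Measure.restrict_apply MeasurableSet.univ, disc,
    Set.univ_inter, Complex.volume_ball, smul_eq_mul]
  rw [← h]
  congr 1
  simp only [ENNReal.ofReal_one, one_pow, one_mul]
  rw [ENNReal.ofReal_eq_coe_nnreal Real.pi_pos.le]
  rfl

theorem ae_mem_disc : ∀ᵐ z ∂areaMeasure, z ∈ disc :=
  Measure.ae_smul_measure (ae_restrict_mem isOpen_disc.measurableSet) _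

theorem aestronglyMeasurable_of_continuousOn_disc {F : ℂ → ℂ} (hF : ContinuousOn F disc) :
    AEStronglyMeasurable F areaMeasure :=
  (hF.aestronglyMeasurable isOpen_disc.measurableSet).mono_ac Measure.smul_absolutelyContinuous

/-! ### Taylor coefficients as radially weighted area integrals. -/

/-- Integration over the disc in polar coordinates. -/
theorem integral_areaMeasure_polar {F : ℂ → ℂ} (hc : ContinuousOn F disc)
    (hF : Integrable F areaMeasure) :
    ∫ w, F w ∂areaMeasure = (Real.pi : ℂ)⁻¹ *
      ∫ r in Set.Ioo (0 : ℝ) 1, ∫ θ in Set.Ioo (-Real.pi) Real.pi, r * F (circleMap 0 r θ) := by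
  have hpol (p : ℝ × ℝ) : Complex.polarCoord.symm p = circleMap 0 p.1 p.2 := by
    simp [circleMap, Complex.exp_mul_I]
  set S : Set (ℝ × ℝ) := Set.Ioo 0 1 ×ˢ Set.Ioo (-Real.pi) Real.pi with hS
  have hSm : MeasurableSet S := measurableSet_Ioo.prod measurableSet_Ioo
  have hST : S ⊆ polarCoord.target := by
    rw [polarCoord_target]
    exact Set.prod_mono (fun x hx => hx.1) subset_rfl
  have hmem {p : ℝ × ℝ} (hp : p ∈ polarCoord.target) : circleMap 0 p.1 p.2 ∈ disc ↔ p ∈ S := by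
    rw [polarCoord_target] at hp
    have h0 : 0 < p.1 := hp.1
    simp only [mem_disc, norm_circleMap_zero, abs_of_pos h0, hS, Set.mem_prod, Set.mem_Ioo, h0,
      true_and]
    exact ⟨fun h => ⟨h, hp.2⟩, fun h => h.1⟩
  have hFd : IntegrableOn F disc := by
    have : volume.restrict disc = ENNReal.ofReal Real.pi • areaMeasure := by
      rw [areaMeasure, smul_smul, ← ENNReal.ofReal_mul Real.pi_pos.le,
        mul_inv_cancel₀ Real.pi_ne_zero, ENNReal.ofReal_one, one_smul]
    rw [IntegrableOn, this]
    exact hF.smul_measure ENNReal.ofReal_ne_top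
  have hint : IntegrableOn (fun p : ℝ × ℝ => (p.1 : ℂ) * F (circleMap 0 p.1 p.2)) S := by
    refine ⟨ContinuousOn.aestronglyMeasurable ?_ hSm, ?_⟩
    · refine ContinuousOn.mul (by fun_prop) (hc.comp ?_ ?_)
      · unfold circleMap; fun_prop
      · exact fun p hp => (hmem (hST hp)).2 hp
    · have h2 := hFd.2
      rw [HasFiniteIntegral, ← lintegral_indicator isOpen_disc.measurableSet,
        ← Complex.lintegral_comp_polarCoord_symm] at h2
      refine lt_of_le_of_lt ?_ h2
      refine le_trans ?_ (lintegral_mono_set hST)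
      refine setLIntegral_mono' hSm fun p hp => ?_
      rw [hpol, Set.indicator_of_mem ((hmem (hST hp)).2 hp), enorm_mul, smul_eq_mul]
      gcongr
      rw [← ofReal_norm, Complex.norm_real, Real.norm_of_nonneg hp.1.1.le]
  have h1 : ∫ w in disc, F w = ∫ p in S, (p.1 : ℂ) * F (circleMap 0 p.1 p.2) := by
    rw [← integral_indicator isOpen_disc.measurableSet, ← Complex.integral_comp_polarCoord_symm]
    have : S = polarCoord.target ∩ S := (Set.inter_eq_right.2 hST).symm
    rw [this, ← setIntegral_indicator hSm]
    refine setIntegral_congr_fun polarCoord.open_target.measurableSet fun p hp => ?_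
    simp only [hpol]
    by_cases h : p ∈ S
    · rw [Set.indicator_of_mem ((hmem hp).2 h), Set.indicator_of_mem h, Complex.real_smul]
    · rw [Set.indicator_of_notMem (mt (hmem hp).1 h), Set.indicator_of_notMem h, smul_zero]
  rw [areaMeasure, integral_smul_measure, h1, Measure.volume_eq_prod, setIntegral_prod _ hint,
    ENNReal.toReal_ofReal (by positivity), Complex.real_smul, Complex.ofReal_inv]

theorem conj_circleMap_zero (r θ : ℝ) : conj (circleMap 0 r θ) = circleMap 0 r (-θ) := by
  simp [circleMap, ← Complex.exp_conj]

theorem integral_exp_int_mul_I (m : ℤ) :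
    ∫ θ in (-Real.pi)..Real.pi, Complex.exp (m * θ * Complex.I) =
      if m = 0 then 2 * (Real.pi : ℂ) else 0 := by
  split_ifs with h
  · subst h; simp; ring
  · have hc : (m * Complex.I : ℂ) ≠ 0 := by simp [h]
    have : ∀ θ : ℝ, Complex.exp (m * θ * Complex.I) = Complex.exp ((m * Complex.I) * θ) :=
      fun θ => by ring_nf
    simp_rw [this]
    rw [integral_exp_mul_complex hc]
    -- The endpoints differ by `m` periods of `exp`, so the primitive takes equal values there.
    have h2 : (m * Complex.I * (Real.pi : ℝ) : ℂ) =
        m * Complex.I * ((-Real.pi : ℝ) : ℂ) + m * (2 * Real.pi * Complex.I) := by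
      push_cast; ring
    rw [h2, Complex.exp_periodic.int_mul m]
    simp

/-- Cauchy's formula for the Taylor coefficients, as a mean over a circle. -/
theorem integral_circle_mul_conj_pow {F : ℂ → ℂ} {a : ℕ → ℂ}
    (ha : ∀ w ∈ disc, HasSum (fun k => a k * w ^ k) (F w)) {r : ℝ} (hr : r ∈ Set.Ioo (0 : ℝ) 1)
    (n : ℕ) :
    ∫ θ in Set.Ioo (-Real.pi) Real.pi, F (circleMap 0 r θ) * conj (circleMap 0 r θ) ^ n =
      2 * Real.pi * a n * r ^ (2 * n) := by
  have hmem (θ : ℝ) : circleMap 0 r θ ∈ disc := by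
    simpa [mem_disc, abs_of_pos hr.1] using hr.2
  have hsum : Summable fun k => ‖a k‖ * r ^ k := by
    have := (ha r (by simpa [mem_disc, abs_of_pos hr.1] using hr.2)).summable.norm
    simpa [abs_of_pos hr.1] using this
  have hpi : -Real.pi ≤ Real.pi := by linarith [Real.pi_pos]
  rw [← integral_Ioc_eq_integral_Ioo, ← intervalIntegral.integral_of_le hpi]
  have key := intervalIntegral.hasSum_integral_of_dominated_convergence (a := -Real.pi)
    (b := Real.pi) (μ := volume)
    (F := fun k θ => a k * circleMap 0 r θ ^ k * conj (circleMap 0 r θ) ^ n)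
    (f := fun θ => F (circleMap 0 r θ) * conj (circleMap 0 r θ) ^ n)
    (fun k _ => ‖a k‖ * r ^ k * r ^ n)
    (fun k => (Continuous.aestronglyMeasurable (by unfold circleMap; fun_prop)))
    (fun k => .of_forall fun θ _ => by simp [abs_of_pos hr.1])
    (.of_forall fun θ _ => hsum.mul_right _)
    (by simp)
    (.of_forall fun θ _ => (ha _ (hmem θ)).mul_right _)
  refine key.unique ?_
  -- Orthogonality of the characters leaves only the term `k = n`.
  have hterm (k : ℕ) : ∫ θ in (-Real.pi)..Real.pi,
      a k * circleMap 0 r θ ^ k * conj (circleMap 0 r θ) ^ n =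
      if k = n then 2 * Real.pi * a n * r ^ (2 * n) else 0 := by
    have h1 (θ : ℝ) : a k * circleMap 0 r θ ^ k * conj (circleMap 0 r θ) ^ n =
        (a k * r ^ k * r ^ n) * Complex.exp (((k - n : ℤ) : ℂ) * θ * Complex.I) := by
      rw [conj_circleMap_zero]
      simp only [circleMap, zero_add, mul_pow, ← Complex.exp_nat_mul]
      rw [show (((k - n : ℤ) : ℂ) * θ * Complex.I) =
        k * (θ * Complex.I) + n * (((-θ : ℝ) : ℂ) * Complex.I) by push_cast; ring,
        Complex.exp_add]
      ring
    simp_rw [h1]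
    rw [intervalIntegral.integral_const_mul, integral_exp_int_mul_I]
    by_cases h : k = n
    · subst h; simp; ring
    · have : (k - n : ℤ) ≠ 0 := by omega
      simp [h, this]
  simp_rw [hterm]
  exact hasSum_ite_eq n _

/-- Integration of an analytic function against `w̄ ^ n φ(|w|)` picks out its `n`-th coefficient. -/
theorem integral_mul_conj_pow_mul_radial {F : ℂ → ℂ} {a : ℕ → ℂ} (hc : ContinuousOn F disc)
    (hF : Integrable F areaMeasure) (ha : ∀ w ∈ disc, HasSum (fun k => a k * w ^ k) (F w))
    {φ : ℝ → ℝ} (hφ : Continuous φ) (n : ℕ) :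
    ∫ w, F w * conj w ^ n * φ ‖w‖ ∂areaMeasure =
      a n * ((2 * ∫ r in (0 : ℝ)..1, φ r * r ^ (2 * n + 1) : ℝ) : ℂ) := by
  obtain ⟨C, hC⟩ := (isCompact_closedBall (0 : ℂ) 1).exists_bound_of_continuousOn
    (f := fun w : ℂ => conj w ^ n * (φ ‖w‖ : ℂ)) (by fun_prop)
  have hc' : ContinuousOn (fun w => F w * conj w ^ n * (φ ‖w‖ : ℂ)) disc := by fun_prop
  have hint : Integrable (fun w => F w * conj w ^ n * (φ ‖w‖ : ℂ)) areaMeasure := by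
    refine (hF.norm.mul_const C).mono' (aestronglyMeasurable_of_continuousOn_disc hc') ?_
    filter_upwards [ae_mem_disc] with w hw
    rw [mul_assoc, norm_mul]
    gcongr
    exact hC w (Metric.ball_subset_closedBall hw)
  rw [integral_areaMeasure_polar hc' hint]
  have h1 : ∀ r ∈ Set.Ioo (0 : ℝ) 1, (∫ θ in Set.Ioo (-Real.pi) Real.pi,
      (r : ℂ) * (F (circleMap 0 r θ) * conj (circleMap 0 r θ) ^ n * (φ ‖circleMap 0 r θ‖ : ℂ))) =
      2 * Real.pi * a n * ((φ r * r ^ (2 * n + 1) : ℝ) : ℂ) := by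
    intro r hr
    simp_rw [norm_circleMap_zero, abs_of_pos hr.1]
    rw [integral_const_mul, integral_mul_const, integral_circle_mul_conj_pow ha hr]
    push_cast; ring
  rw [setIntegral_congr_fun measurableSet_Ioo h1, integral_const_mul, integral_complex_ofReal,
    ← integral_Ioc_eq_integral_Ioo, ← intervalIntegral.integral_of_le zero_le_one]
  have : (Real.pi : ℂ) ≠ 0 := by exact_mod_cast Real.pi_ne_zero
  push_cast
  field_simp

/-- Termwise integration of an analytic function against a conjugate power series with absolutely
summable coefficients and a continuous radial weight. -/
theorem hasSum_integral_mul_radial {F G : ℂ → ℂ} {a c : ℕ → ℂ} (hc : ContinuousOn F disc)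
    (hF : Integrable F areaMeasure) (ha : ∀ w ∈ disc, HasSum (fun k => a k * w ^ k) (F w))
    (hs : Summable fun k => ‖c k‖) (hG : ∀ w ∈ disc, HasSum (fun k => c k * conj w ^ k) (G w))
    {φ : ℝ → ℝ} (hφ : Continuous φ) :
    HasSum (fun k => c k * (a k * ((2 * ∫ r in (0 : ℝ)..1, φ r * r ^ (2 * k + 1) : ℝ) : ℂ)))
      (∫ w, F w * G w * φ ‖w‖ ∂areaMeasure) := by
  obtain ⟨C, hC⟩ := (isCompact_closedBall (0 : ℂ) 1).exists_bound_of_continuousOn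
    (f := fun w : ℂ => (φ ‖w‖ : ℂ)) (by fun_prop)
  have key := hasSum_integral_of_dominated_convergence (μ := areaMeasure)
    (F := fun k w => c k * (F w * conj w ^ k * (φ ‖w‖ : ℂ)))
    (f := fun w => F w * G w * (φ ‖w‖ : ℂ))
    (fun k w => ‖c k‖ * (‖F w‖ * C))
    (fun k => aestronglyMeasurable_of_continuousOn_disc (by fun_prop))
    (fun k => by
      filter_upwards [ae_mem_disc] with w hw
      rw [norm_mul, norm_mul, norm_mul, norm_pow, RCLike.norm_conj]
      have h1 : ‖w‖ ^ k ≤ 1 := pow_le_one₀ (norm_nonneg _) (mem_disc.1 hw).le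
      have h2 := hC w (Metric.ball_subset_closedBall hw)
      gcongr
      exact mul_le_of_le_one_right (norm_nonneg _) h1)
    (.of_forall fun w => hs.mul_right _)
    (by
      simp_rw [tsum_mul_right]
      exact (hF.norm.mul_const C).const_mul _)
    (by
      filter_upwards [ae_mem_disc] with w hw
      have := ((hG w hw).mul_left (F w)).mul_right (φ ‖w‖ : ℂ)
      refine this.congr_fun fun k => ?_
      ring)
  refine key.congr_fun fun k => ?_
  rw [integral_const_mul, integral_mul_conj_pow_mul_radial hc hF ha hφ]

theorem two_mul_integral_pow (n : ℕ) :
    2 * ∫ r in (0 : ℝ)..1, r ^ 2 * r ^ (2 * n + 1) = (1 / (n + 2) : ℝ) := by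
  simp_rw [← pow_add]
  rw [integral_pow]
  push_cast
  field_simp
  simp; ring

/-- This factor undoes two differentiations of `z ^ (n + 2)`, which is why the weight `1 - |w|^2`
reproduces `f` from `f''`. -/
theorem two_mul_integral_one_sub_sq_mul_pow (n : ℕ) :
    2 * (∫ r in (0 : ℝ)..1, (1 - r ^ 2) * r ^ (2 * n + 1)) = (1 / ((n + 1) * (n + 2)) : ℝ) := by
  simp_rw [sub_mul, one_mul]
  rw [intervalIntegral.integral_sub (Continuous.intervalIntegrable (by fun_prop) _ _)
    (Continuous.intervalIntegrable (by fun_prop) _ _), mul_sub, two_mul_integral_pow, integral_pow]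
  push_cast
  field_simp
  simp; ring

/-! ### The derivative kernel and its `L^2` bound. -/

theorem hasSum_add_two_mul_pow {x : ℂ} (hx : ‖x‖ < 1) :
    HasSum (fun k : ℕ => ((k : ℂ) + 2) * x ^ k) ((2 - x) / (1 - x) ^ 2) := by
  have h1 := (hasSum_coe_mul_geometric_of_norm_lt_one hx).add
    ((hasSum_geometric_of_norm_lt_one hx).mul_left 2)
  have hne : 1 - x ≠ 0 := by
    rw [sub_ne_zero]; rintro rfl; simp at hx
  have h2 : (2 - x) / (1 - x) ^ 2 = x / (1 - x) ^ 2 + 2 * (1 - x)⁻¹ := by field_simp; ring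
  rw [h2]
  exact h1.congr_fun fun k => by ring

theorem summable_norm_add_two_mul_pow {x : ℂ} (hx : ‖x‖ < 1) :
    Summable fun k : ℕ => ‖((k : ℂ) + 2) * x ^ k‖ :=
  (hasSum_add_two_mul_pow hx).summable.norm

theorem norm_mul_conj_lt_one {z w : ℂ} (hz : z ∈ disc) (hw : w ∈ disc) : ‖z * conj w‖ < 1 := by
  rw [norm_mul, RCLike.norm_conj]
  exact mul_lt_one_of_nonneg_of_lt_one_left (norm_nonneg _) (mem_disc.1 hz) (mem_disc.1 hw).le

/-- The kernel reproducing `f' - f' 0` from `f''`. -/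
noncomputable def derivKernel (z w : ℂ) : ℂ :=
  z * ((2 - z * conj w) / (1 - z * conj w) ^ 2) * ((1 - ‖w‖ ^ 2 : ℝ) : ℂ)

theorem measurable_derivKernel : Measurable fun p : ℂ × ℂ => derivKernel p.1 p.2 := by
  unfold derivKernel
  have h : Measurable fun p : ℂ × ℂ => conj p.2 :=
    (RCLike.continuous_conj.comp continuous_snd).measurable
  fun_prop

/-- By orthogonality the integral is `(1 - |w|^2)^2 ∑ (k+2)^2 |w|^(2k) / (k+2)`. The series sums to
`(2 - |w|^2) / (1 - |w|^2)^2`, so the exact value is `2 - |w|^2`. -/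
theorem lintegral_derivKernel_sq_le {w : ℂ} (hw : w ∈ disc) :
    ∫⁻ z, ‖derivKernel z w‖ₑ ^ 2 ∂areaMeasure ≤ 2 := by
  set H : ℂ → ℂ := fun z => (2 - z * conj w) / (1 - z * conj w) ^ 2 with hH
  have hwn := mem_disc.1 hw
  have hcw : ‖conj w‖ < 1 := by rwa [RCLike.norm_conj]
  have hHc : ContinuousOn H (Metric.closedBall 0 1) := by
    refine ContinuousOn.div (by fun_prop) (by fun_prop) fun z hz => pow_ne_zero 2 ?_
    rw [sub_ne_zero]; intro h
    have h2 : ‖z * conj w‖ < 1 := by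
      rw [norm_mul]
      exact mul_lt_one_of_nonneg_of_lt_one_right (by simpa using hz) (norm_nonneg _) hcw
    rw [← h] at h2
    simp at h2
  obtain ⟨C, hC⟩ := (isCompact_closedBall (0 : ℂ) 1).exists_bound_of_continuousOn hHc
  have hHd : ContinuousOn H disc := hHc.mono Metric.ball_subset_closedBall
  have hHi : Integrable H areaMeasure := by
    refine (integrable_const C).mono' (aestronglyMeasurable_of_continuousOn_disc hHd) ?_
    filter_upwards [ae_mem_disc] with z hz using hC z (Metric.ball_subset_closedBall hz)
  have hHs : ∀ z ∈ disc, HasSum (fun k : ℕ => ((k : ℂ) + 2) * conj w ^ k * z ^ k) (H z) := by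
    intro z hz
    refine (hasSum_add_two_mul_pow (norm_mul_conj_lt_one hz hw)).congr_fun fun k => ?_
    rw [mul_pow]; ring
  have hGs : ∀ z ∈ disc, HasSum (fun k : ℕ => ((k : ℂ) + 2) * w ^ k * conj z ^ k)
      (conj (H z)) := by
    intro z hz
    refine (Complex.hasSum_conj'.2 (hHs z hz)).congr_fun fun k => ?_
    simp [map_ofNat (starRingEnd ℂ) 2]
  -- The weight `r ^ 2` is the factor `|z|^2` coming from the leading `z` of the kernel.
  have key := hasSum_integral_mul_radial hHd hHi hHs (summable_norm_add_two_mul_pow hwn) hGs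
    (φ := fun r => r ^ 2) (by fun_prop)
  have hx : ‖((‖w‖ ^ 2 : ℝ) : ℂ)‖ < 1 := by
    rw [Complex.norm_real, Real.norm_of_nonneg (by positivity)]
    exact pow_lt_one₀ (norm_nonneg _) hwn two_ne_zero
  have hval := key.unique ((hasSum_add_two_mul_pow hx).congr_fun fun k => by
    rw [two_mul_integral_pow]
    have h2 : (k : ℂ) + 2 ≠ 0 := by exact_mod_cast (by positivity : (k : ℝ) + 2 ≠ 0)
    have h3 : w ^ k * conj w ^ k = ((‖w‖ ^ 2 : ℝ) : ℂ) ^ k := by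
      rw [← mul_pow, Complex.mul_conj']; push_cast; rfl
    rw [← h3]
    push_cast
    field_simp)
  have hreal : ∫ z, ‖derivKernel z w‖ ^ 2 ∂areaMeasure = 2 - ‖w‖ ^ 2 := by
    have h1 : ∀ z, (((‖derivKernel z w‖ ^ 2 : ℝ)) : ℂ) =
        ((1 - ‖w‖ ^ 2 : ℝ) : ℂ) ^ 2 * (H z * conj (H z) * ((‖z‖ ^ 2 : ℝ) : ℂ)) := by
      intro z
      rw [Complex.mul_conj']
      simp only [derivKernel, norm_mul, mul_pow, Complex.norm_real, Real.norm_eq_abs, sq_abs, hH]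
      push_cast; ring
    have hne : ((1 : ℂ) - (‖w‖ : ℂ) ^ 2) ≠ 0 := by
      have : (1 - ‖w‖ ^ 2 : ℝ) ≠ 0 := by nlinarith [norm_nonneg w]
      exact_mod_cast this
    apply Complex.ofReal_injective
    rw [← integral_complex_ofReal]
    simp_rw [h1]
    rw [integral_const_mul, hval]
    push_cast
    field_simp
  -- For fixed `w` in the disc the kernel is bounded in `z`; integrability is what transfers the
  -- value just computed to the lower integral.
  have hint : Integrable (fun z => ‖derivKernel z w‖ ^ 2) areaMeasure := by
    refine (integrable_const ((1 * C * (1 - ‖w‖ ^ 2)) ^ 2)).mono' ?_ ?_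
    · have : Measurable fun z => derivKernel z w :=
        measurable_derivKernel.comp (measurable_id.prodMk measurable_const)
      exact (this.norm.pow_const 2).aestronglyMeasurable
    · filter_upwards [ae_mem_disc] with z hz
      have h0 : (0 : ℝ) ≤ 1 - ‖w‖ ^ 2 := by nlinarith [norm_nonneg w]
      have hz' := (mem_disc.1 hz).le
      have hC' := hC z (Metric.ball_subset_closedBall hz)
      rw [Real.norm_of_nonneg (by positivity)]
      simp only [derivKernel, norm_mul, Complex.norm_real, Real.norm_of_nonneg h0]
      gcongr
  have : ∀ z, ‖derivKernel z w‖ₑ ^ 2 = ENNReal.ofReal (‖derivKernel z w‖ ^ 2) := by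
    intro z
    rw [ENNReal.ofReal_pow (norm_nonneg _), ofReal_norm]
  simp_rw [this]
  rw [← ofReal_integral_eq_lintegral_ofReal hint (.of_forall fun z => by positivity), hreal]
  refine (ENNReal.ofReal_le_ofReal (show 2 - ‖w‖ ^ 2 ≤ 2 by nlinarith [norm_nonneg w])).trans ?_
  simp

/-! ### Reproducing formulas and pointwise bounds. -/

theorem hasSum_taylor_disc {f : ℂ → ℂ} (hf : DifferentiableOn ℂ f disc) {z : ℂ} (hz : z ∈ disc) :
    HasSum (fun n : ℕ => iteratedDeriv n f 0 / n.factorial * z ^ n) (f z) := by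
  refine (Complex.hasSum_taylorSeries_on_ball hf hz).congr_fun fun n => ?_
  simp only [smul_eq_mul, sub_zero]
  field_simp

theorem differentiableOn_deriv {f : ℂ → ℂ} (hf : DifferentiableOn ℂ f disc) :
    DifferentiableOn ℂ (deriv f) disc := hf.deriv isOpen_disc

theorem MemB1.integrable {f : ℂ → ℂ} (hf : MemB1 f) :
    Integrable (deriv (deriv f)) areaMeasure := by
  refine ⟨(measurable_deriv _).aestronglyMeasurable, ?_⟩
  exact lt_of_le_of_lt le_add_self hf.2

/-- The reproducing formula for `f` in terms of `f''`. -/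
theorem MemB1.integral_eq {f : ℂ → ℂ} (hf : MemB1 f) {z : ℂ} (hz : z ∈ disc) :
    ∫ w, deriv (deriv f) w * (z ^ 2 / (1 - z * conj w)) * ((1 - ‖w‖ ^ 2 : ℝ) : ℂ) ∂areaMeasure =
      f z - f 0 - deriv f 0 * z := by
  have hd := differentiableOn_deriv (differentiableOn_deriv hf.1)
  have hzn := mem_disc.1 hz
  have hG : ∀ w ∈ disc, HasSum (fun k : ℕ => z ^ 2 * z ^ k * conj w ^ k)
      (z ^ 2 / (1 - z * conj w)) := fun w hw => by
    rw [div_eq_mul_inv]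
    refine ((hasSum_geometric_of_norm_lt_one (norm_mul_conj_lt_one hz hw)).mul_left _).congr_fun
      fun k => ?_
    rw [mul_pow]; ring
  have key := hasSum_integral_mul_radial hd.continuousOn hf.integrable
    (fun w hw => hasSum_taylor_disc hd hw)
    (((hasSum_geometric_of_norm_lt_one hzn).mul_left (z ^ 2)).summable.norm) hG
    (φ := fun r => 1 - r ^ 2) (by fun_prop)
  refine key.unique ?_
  -- Dropping the first two Taylor terms aligns the index with the coefficients of `f''`.
  have ht := (hasSum_nat_add_iff' 2).2 (hasSum_taylor_disc hf.1 hz)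
  have e : f z - f 0 - deriv f 0 * z =
      f z - ∑ n ∈ Finset.range 2, iteratedDeriv n f 0 / n.factorial * z ^ n := by
    simp [Finset.sum_range_succ, iteratedDeriv_one]; ring
  rw [e]
  refine ht.congr_fun fun k => ?_
  rw [two_mul_integral_one_sub_sq_mul_pow, iteratedDeriv_succ', iteratedDeriv_succ',
    Nat.factorial_succ, Nat.factorial_succ]
  have h1 : (k : ℂ) + 1 ≠ 0 := by exact_mod_cast (by positivity : (k : ℝ) + 1 ≠ 0)
  have h2 : (k : ℂ) + 2 ≠ 0 := by exact_mod_cast (by positivity : (k : ℝ) + 2 ≠ 0)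
  have h3 : (k : ℂ) + 1 + 1 ≠ 0 := by exact_mod_cast (by positivity : (k : ℝ) + 1 + 1 ≠ 0)
  have h4 : (k.factorial : ℂ) ≠ 0 := by exact_mod_cast k.factorial_ne_zero
  push_cast
  field_simp
  ring

/-- The reproducing formula for `f'` in terms of `f''`. -/
theorem MemB1.integral_derivKernel_eq {f : ℂ → ℂ} (hf : MemB1 f) {z : ℂ} (hz : z ∈ disc) :
    ∫ w, deriv (deriv f) w * derivKernel z w ∂areaMeasure = deriv f z - deriv f 0 := by
  have hd1 := differentiableOn_deriv hf.1
  have hd := differentiableOn_deriv hd1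
  have hzn := mem_disc.1 hz
  have hG : ∀ w ∈ disc, HasSum (fun k : ℕ => z * ((k + 2) * z ^ k) * conj w ^ k)
      (z * ((2 - z * conj w) / (1 - z * conj w) ^ 2)) := fun w hw => by
    refine ((hasSum_add_two_mul_pow (norm_mul_conj_lt_one hz hw)).mul_left _).congr_fun
      fun k => ?_
    rw [mul_pow]; ring
  have key := hasSum_integral_mul_radial hd.continuousOn hf.integrable
    (fun w hw => hasSum_taylor_disc hd hw)
    (((hasSum_add_two_mul_pow hzn).mul_left z).summable.norm) hG
    (φ := fun r => 1 - r ^ 2) (by fun_prop)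
  simp only [derivKernel, ← mul_assoc] at key ⊢
  refine key.unique ?_
  have ht := (hasSum_nat_add_iff' 1).2 (hasSum_taylor_disc hd1 hz)
  have e : deriv f z - deriv f 0 = deriv f z -
      ∑ n ∈ Finset.range 1, iteratedDeriv n (deriv f) 0 / n.factorial * z ^ n := by simp
  rw [e]
  refine ht.congr_fun fun k => ?_
  rw [two_mul_integral_one_sub_sq_mul_pow, iteratedDeriv_succ', Nat.factorial_succ]
  have h1 : (k : ℂ) + 1 ≠ 0 := by exact_mod_cast (by positivity : (k : ℝ) + 1 ≠ 0)
  have h2 : (k : ℂ) + 2 ≠ 0 := by exact_mod_cast (by positivity : (k : ℝ) + 2 ≠ 0)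
  have h4 : (k.factorial : ℂ) ≠ 0 := by exact_mod_cast k.factorial_ne_zero
  push_cast
  field_simp
  ring

/-- Functions in `B_1` are bounded. -/
theorem MemB1.enorm_le {f : ℂ → ℂ} (hf : MemB1 f) {z : ℂ} (hz : z ∈ disc) :
    ‖f z‖ₑ ≤ ‖f 0‖ₑ + ‖deriv f 0‖ₑ + 2 * ∫⁻ w, ‖deriv (deriv f) w‖ₑ ∂areaMeasure := by
  have hzn := mem_disc.1 hz
  have h1 : f z = f 0 + deriv f 0 * z + ∫ w, deriv (deriv f) w * (z ^ 2 / (1 - z * conj w)) *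
      ((1 - ‖w‖ ^ 2 : ℝ) : ℂ) ∂areaMeasure := by
    rw [hf.integral_eq hz]; ring
  have h2 : ‖∫ w, deriv (deriv f) w * (z ^ 2 / (1 - z * conj w)) *
      ((1 - ‖w‖ ^ 2 : ℝ) : ℂ) ∂areaMeasure‖ₑ ≤
      2 * ∫⁻ w, ‖deriv (deriv f) w‖ₑ ∂areaMeasure := by
    refine (enorm_integral_le_lintegral_enorm _).trans ?_
    rw [← lintegral_const_mul _ (measurable_deriv _).enorm]
    refine lintegral_mono_ae ?_
    filter_upwards [ae_mem_disc] with w hw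
    have hwn := mem_disc.1 hw
    -- The 2 comes from `1 - |w|^2 ≤ 2 (1 - |w|)` together with `1 - |w| ≤ |1 - z w̄|`.
    have hk : ‖z ^ 2 / (1 - z * conj w) * ((1 - ‖w‖ ^ 2 : ℝ) : ℂ)‖ ≤ 2 := by
      have h0 : (0 : ℝ) ≤ 1 - ‖w‖ ^ 2 := by nlinarith [norm_nonneg w]
      have h3 : 1 - ‖w‖ ≤ ‖1 - z * conj w‖ := by
        have h4 := norm_sub_norm_le (1 : ℂ) (z * conj w)
        rw [norm_one, norm_mul, RCLike.norm_conj] at h4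
        nlinarith [norm_nonneg w]
      have h5 : 0 < ‖1 - z * conj w‖ := by linarith
      rw [norm_mul, norm_div, norm_pow, Complex.norm_real, Real.norm_of_nonneg h0,
        div_mul_eq_mul_div, div_le_iff₀ h5]
      have h6 : ‖z‖ ^ 2 ≤ 1 := pow_le_one₀ (norm_nonneg _) hzn.le
      calc ‖z‖ ^ 2 * (1 - ‖w‖ ^ 2) ≤ 1 * (1 - ‖w‖ ^ 2) := by gcongr
        _ ≤ 2 * (1 - ‖w‖) := by nlinarith [norm_nonneg w]
        _ ≤ _ := by gcongr
    rw [mul_assoc, enorm_mul, mul_comm]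
    gcongr
    rw [← ofReal_norm]
    exact (ENNReal.ofReal_le_ofReal hk).trans (by simp)
  calc ‖f z‖ₑ ≤ ‖f 0‖ₑ + ‖deriv f 0 * z‖ₑ + _ := by
        conv_lhs => rw [h1]
        exact (enorm_add_le _ _).trans (add_le_add_left (enorm_add_le _ _) _)
    _ ≤ _ := by
        gcongr
        rw [enorm_mul]
        refine mul_le_of_le_one_right' ?_
        rw [← ofReal_norm]
        exact ENNReal.ofReal_le_one.2 hzn.le

theorem MemB1.enorm_deriv_le {f : ℂ → ℂ} (hf : MemB1 f) {z : ℂ} (hz : z ∈ disc) :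
    ‖deriv f z‖ₑ ≤ ‖deriv f 0‖ₑ +
      ∫⁻ w, ‖deriv (deriv f) w‖ₑ * ‖derivKernel z w‖ₑ ∂areaMeasure := by
  have h1 : deriv f z = deriv f 0 + ∫ w, deriv (deriv f) w * derivKernel z w ∂areaMeasure := by
    rw [hf.integral_derivKernel_eq hz]; ring
  calc ‖deriv f z‖ₑ ≤ ‖deriv f 0‖ₑ + ‖∫ w, deriv (deriv f) w * derivKernel z w ∂areaMeasure‖ₑ := by
        conv_lhs => rw [h1]
        exact enorm_add_le _ _
    _ ≤ _ := by
        gcongr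
        refine (enorm_integral_le_lintegral_enorm _).trans_eq ?_
        simp_rw [enorm_mul]

/-! ### The bilinear estimate for `f' g'`. -/

theorem two_mul_le_sq_add_sq (x y : ℝ≥0∞) : 2 * (x * y) ≤ x ^ 2 + y ^ 2 := by
  wlog h : x ≤ y generalizing x y
  · rw [mul_comm x, add_comm]
    exact this y x (le_of_not_ge h)
  obtain ⟨d, rfl⟩ := exists_add_of_le h
  calc 2 * (x * (x + d)) ≤ 2 * (x * (x + d)) + d ^ 2 := le_self_add
    _ = _ := by ring

theorem le_one_add_sq (x : ℝ≥0∞) : x ≤ 1 + x ^ 2 := by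
  rcases le_total x 1 with h | h
  · exact h.trans le_self_add
  · calc x = x * 1 := (mul_one x).symm
      _ ≤ x * x := by gcongr
      _ = x ^ 2 := (sq x).symm
      _ ≤ _ := le_add_self

theorem measurable_enorm_derivKernel (w : ℂ) : Measurable fun z => ‖derivKernel z w‖ₑ :=
  (measurable_derivKernel.comp (measurable_id.prodMk measurable_const)).enorm

/-- Pointwise `2xy ≤ x^2 + y^2` suffices in place of Cauchy–Schwarz, because both `L^2` bounds are
the same. -/
theorem lintegral_derivKernel_mul_le {v w : ℂ} (hv : v ∈ disc) (hw : w ∈ disc) :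
    ∫⁻ z, ‖derivKernel z v‖ₑ * ‖derivKernel z w‖ₑ ∂areaMeasure ≤ 2 := by
  have hm := measurable_enorm_derivKernel
  have hvw : Measurable fun z => ‖derivKernel z v‖ₑ * ‖derivKernel z w‖ₑ := (hm v).mul (hm w)
  have h : 2 * ∫⁻ z, ‖derivKernel z v‖ₑ * ‖derivKernel z w‖ₑ ∂areaMeasure ≤ 2 * 2 := by
    rw [← lintegral_const_mul _ hvw]
    calc _ ≤ ∫⁻ z, (‖derivKernel z v‖ₑ ^ 2 + ‖derivKernel z w‖ₑ ^ 2) ∂areaMeasure :=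
          lintegral_mono fun z => two_mul_le_sq_add_sq _ _
      _ = _ := lintegral_add_left ((hm v).pow_const 2) _
      _ ≤ 2 + 2 := add_le_add (lintegral_derivKernel_sq_le hv) (lintegral_derivKernel_sq_le hw)
      _ = 2 * 2 := (two_mul 2).symm
  exact (ENNReal.mul_le_mul_iff_right two_ne_zero ENNReal.ofNat_ne_top).1 h

theorem lintegral_derivKernel_le {w : ℂ} (hw : w ∈ disc) :
    ∫⁻ z, ‖derivKernel z w‖ₑ ∂areaMeasure ≤ 3 := by
  calc _ ≤ ∫⁻ z, (1 + ‖derivKernel z w‖ₑ ^ 2) ∂areaMeasure :=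
        lintegral_mono fun z => le_one_add_sq _
    _ = 1 + ∫⁻ z, ‖derivKernel z w‖ₑ ^ 2 ∂areaMeasure := by
        rw [lintegral_add_left measurable_const, lintegral_const, areaMeasure_univ, one_mul]
    _ ≤ 1 + 2 := by gcongr; exact lintegral_derivKernel_sq_le hw
    _ = 3 := by norm_num

/-- Tonelli's theorem for an integral operator, with a bound on the inner integral. -/
theorem lintegral_mul_lintegral_derivKernel_le {u k : ℂ → ℝ≥0∞} (hu : Measurable u)
    (hk : Measurable k) {C : ℝ≥0∞}
    (hC : ∀ w ∈ disc, ∫⁻ z, k z * ‖derivKernel z w‖ₑ ∂areaMeasure ≤ C) :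
    ∫⁻ z, k z * ∫⁻ w, u w * ‖derivKernel z w‖ₑ ∂areaMeasure ∂areaMeasure ≤
      C * ∫⁻ w, u w ∂areaMeasure := by
  have hK : Measurable fun p : ℂ × ℂ => ‖derivKernel p.1 p.2‖ₑ := measurable_derivKernel.enorm
  have h1 (z : ℂ) : k z * ∫⁻ w, u w * ‖derivKernel z w‖ₑ ∂areaMeasure =
      ∫⁻ w, k z * (u w * ‖derivKernel z w‖ₑ) ∂areaMeasure :=
    (lintegral_const_mul _ (hu.mul (hK.comp (measurable_const.prodMk measurable_id)))).symm
  simp_rw [h1]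
  rw [lintegral_lintegral_swap (((hk.comp measurable_fst).mul
    ((hu.comp measurable_snd).mul hK)).aemeasurable), ← lintegral_const_mul _ hu]
  refine lintegral_mono_ae ?_
  filter_upwards [ae_mem_disc] with w hw
  have h2 (z : ℂ) : k z * (u w * ‖derivKernel z w‖ₑ) = u w * (k z * ‖derivKernel z w‖ₑ) := by ring
  simp_rw [h2]
  have h3 : Measurable fun z => k z * ‖derivKernel z w‖ₑ := hk.mul (measurable_enorm_derivKernel w)
  rw [lintegral_const_mul _ h3, mul_comm]
  gcongr
  exact hC w hw

/-- The area integral of `|f' g'|` is controlled by the `B_1` seminorms. -/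
theorem lintegral_deriv_mul_deriv_le {f g : ℂ → ℂ} (hf : MemB1 f) (hg : MemB1 g) :
    ∫⁻ z, ‖deriv f z‖ₑ * ‖deriv g z‖ₑ ∂areaMeasure ≤
      ‖deriv f 0‖ₑ * ‖deriv g 0‖ₑ +
      3 * ‖deriv g 0‖ₑ * ∫⁻ z, ‖deriv (deriv f) z‖ₑ ∂areaMeasure +
      3 * ‖deriv f 0‖ₑ * ∫⁻ z, ‖deriv (deriv g) z‖ₑ ∂areaMeasure +
      2 * (∫⁻ z, ‖deriv (deriv f) z‖ₑ ∂areaMeasure) *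
        ∫⁻ z, ‖deriv (deriv g) z‖ₑ ∂areaMeasure := by
  have hK : Measurable fun p : ℂ × ℂ => ‖derivKernel p.1 p.2‖ₑ := measurable_derivKernel.enorm
  have hmu (f : ℂ → ℂ) : Measurable fun z => ‖deriv (deriv f) z‖ₑ := (measurable_deriv _).enorm
  set E : (ℂ → ℂ) → ℂ → ℝ≥0∞ := fun f z =>
    ∫⁻ w, ‖deriv (deriv f) w‖ₑ * ‖derivKernel z w‖ₑ ∂areaMeasure with hE
  have hmE (f : ℂ → ℂ) : Measurable (E f) :=
    Measurable.lintegral_prod_right' (((hmu f).comp measurable_snd).mul hK)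
  have hconst (c : ℝ≥0∞) (f : ℂ → ℂ) : ∫⁻ z, c * E f z ∂areaMeasure ≤
      3 * c * ∫⁻ z, ‖deriv (deriv f) z‖ₑ ∂areaMeasure := by
    refine lintegral_mul_lintegral_derivKernel_le (hmu f) measurable_const fun w hw => ?_
    rw [lintegral_const_mul _ (measurable_enorm_derivKernel w), mul_comm]
    gcongr
    exact lintegral_derivKernel_le hw
  have hprod : ∫⁻ z, E f z * E g z ∂areaMeasure ≤
      2 * (∫⁻ z, ‖deriv (deriv f) z‖ₑ ∂areaMeasure) *
        ∫⁻ z, ‖deriv (deriv g) z‖ₑ ∂areaMeasure := by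
    -- Tonelli is used twice, with `E f` as outer weight and then with a kernel as outer weight,
    -- until only the integral of two kernels in `z` remains.
    refine lintegral_mul_lintegral_derivKernel_le (hmu g) (hmE f) fun w hw => ?_
    simp_rw [mul_comm (E f _)]
    exact lintegral_mul_lintegral_derivKernel_le (hmu f)
      (measurable_enorm_derivKernel w) fun v hv => lintegral_derivKernel_mul_le hw hv
  calc _ ≤ ∫⁻ z, (‖deriv f 0‖ₑ * ‖deriv g 0‖ₑ + ‖deriv g 0‖ₑ * E f z +
        ‖deriv f 0‖ₑ * E g z + E f z * E g z) ∂areaMeasure := by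
        refine lintegral_mono_ae ?_
        filter_upwards [ae_mem_disc] with z hz
        refine (mul_le_mul' (hf.enorm_deriv_le hz) (hg.enorm_deriv_le hz)).trans_eq ?_
        simp only [hE]
        ring
    _ = ‖deriv f 0‖ₑ * ‖deriv g 0‖ₑ + (∫⁻ z, ‖deriv g 0‖ₑ * E f z ∂areaMeasure) +
        (∫⁻ z, ‖deriv f 0‖ₑ * E g z ∂areaMeasure) + ∫⁻ z, E f z * E g z ∂areaMeasure := by
        have hfg : Measurable fun z => E f z * E g z := (hmE f).mul (hmE g)
        rw [lintegral_add_right _ hfg,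
          lintegral_add_right _ ((hmE g).const_mul _), lintegral_add_right _ ((hmE f).const_mul _),
          lintegral_const, areaMeasure_univ, mul_one]
    _ ≤ _ := by
        gcongr
        · exact hconst _ f
        · exact hconst _ g

/-- The constant 4 is forced by the coefficients of `|f'(0)| ∫ |g''|` (3 + 1) and `∫ |f''| ∫ |g''|`
(2 + 2), each fed by both product-rule terms. -/
theorem enorm_volterra_bound {f g : ℂ → ℂ} (hf : MemB1 f) (hg : MemB1 g) :
    ‖f 0 * deriv g 0‖ₑ +
      ∫⁻ z, ‖deriv f z * deriv g z + f z * deriv (deriv g) z‖ₑ ∂areaMeasure ≤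
      4 * (‖deriv g 0‖ₑ + ∫⁻ z, ‖deriv (deriv g) z‖ₑ ∂areaMeasure) * b1Norm f := by
  have hmu : Measurable fun z => ‖deriv (deriv g) z‖ₑ := (measurable_deriv _).enorm
  have hfp := lintegral_deriv_mul_deriv_le hf hg
  have h1 : ∫⁻ z, ‖f z‖ₑ * ‖deriv (deriv g) z‖ₑ ∂areaMeasure ≤
      (‖f 0‖ₑ + ‖deriv f 0‖ₑ + 2 * ∫⁻ w, ‖deriv (deriv f) w‖ₑ ∂areaMeasure) *
        ∫⁻ z, ‖deriv (deriv g) z‖ₑ ∂areaMeasure := by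
    rw [← lintegral_const_mul _ hmu]
    refine lintegral_mono_ae ?_
    filter_upwards [ae_mem_disc] with z hz
    gcongr
    exact hf.enorm_le hz
  have h2 : ∫⁻ z, ‖deriv f z * deriv g z + f z * deriv (deriv g) z‖ₑ ∂areaMeasure ≤
      (∫⁻ z, ‖deriv f z‖ₑ * ‖deriv g z‖ₑ ∂areaMeasure) +
        ∫⁻ z, ‖f z‖ₑ * ‖deriv (deriv g) z‖ₑ ∂areaMeasure := by
    have hm : Measurable fun z => ‖deriv f z‖ₑ * ‖deriv g z‖ₑ :=
      (measurable_deriv f).enorm.mul (measurable_deriv g).enorm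
    rw [← lintegral_add_left hm]
    refine lintegral_mono fun z => ?_
    refine (enorm_add_le _ _).trans_eq ?_
    rw [enorm_mul, enorm_mul]
  rw [enorm_mul]
  refine (add_le_add_right (h2.trans (add_le_add hfp h1)) _).trans ?_
  unfold b1Norm
  generalize (∫⁻ z, ‖deriv (deriv f) z‖ₑ ∂areaMeasure) = c
  generalize (∫⁻ z, ‖deriv (deriv g) z‖ₑ ∂areaMeasure) = b
  generalize ‖deriv f 0‖ₑ = β
  generalize ‖deriv g 0‖ₑ = a
  generalize ‖f 0‖ₑ = α
  -- The second bracket is the slack that completes every coefficient to 4.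
  calc _ ≤ (α * a + (β * a + 3 * a * c + 3 * β * b + 2 * c * b + (α + β + 2 * c) * b)) +
        (3 * (α * a) + 3 * (β * a) + a * c + 3 * (α * b)) := le_self_add
    _ = _ := by ring

/-! ### The Volterra operator and its norm. -/

theorem zero_mem_disc : (0 : ℂ) ∈ disc := by simp [mem_disc]

/-- `T_g f` is a primitive of `f g'` on the disc. -/
theorem hasDerivAt_volterra {f g : ℂ → ℂ} (hf : DifferentiableOn ℂ f disc)
    (hg : DifferentiableOn ℂ g disc) {z : ℂ} (hz : z ∈ disc) :
    HasDerivAt (volterra g f) (f z * deriv g z) z := by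
  have hH : DifferentiableOn ℂ (fun z => f z * deriv g z) disc := hf.mul (differentiableOn_deriv hg)
  obtain ⟨G, hG⟩ := DifferentiableOn.isExactOn_ball hH
  have hmem {z : ℂ} (hz : z ∈ disc) {t : ℝ} (ht : t ∈ Set.uIcc (0 : ℝ) 1) : (t : ℂ) * z ∈ disc := by
    rw [Set.uIcc_of_le zero_le_one] at ht
    rw [mem_disc, norm_mul, Complex.norm_real, Real.norm_of_nonneg ht.1]
    exact (mul_le_of_le_one_left (norm_nonneg z) ht.2).trans_lt (mem_disc.1 hz)
  -- The segment integral agrees with any primitive `G` of `f g'` up to a constant, by the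
  -- fundamental theorem of calculus along `t z`.
  have heq : ∀ z ∈ disc, volterra g f z = G z - G 0 := by
    intro z hz
    have h := intervalIntegral.integral_eq_sub_of_hasDerivAt (a := 0) (b := 1)
      (f := fun t : ℝ => G (t * z)) (f' := fun t : ℝ => f (t * z) * deriv g (t * z) * z)
      (fun t ht => by
        have h1 : HasDerivAt (fun t : ℝ => (t : ℂ) * z) z t := by
          simpa using (Complex.ofRealCLM.hasDerivAt (x := t)).mul_const z
        simpa [mul_comm, Function.comp_def] using (hG _ (hmem hz ht)).scomp t h1)
      (ContinuousOn.intervalIntegrable (by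
        refine ContinuousOn.mul ?_ continuousOn_const
        exact hH.continuousOn.comp (f := fun t : ℝ => (t : ℂ) * z) (by fun_prop)
          fun t ht => hmem hz ht))
    simpa [volterra] using h
  refine ((hG z hz).sub_const (G 0)).congr_of_eventuallyEq ?_
  filter_upwards [isOpen_disc.mem_nhds hz] with w hw using heq w hw

theorem b1Norm_volterra {f g : ℂ → ℂ} (hf : DifferentiableOn ℂ f disc)
    (hg : DifferentiableOn ℂ g disc) :
    b1Norm (volterra g f) = ‖f 0 * deriv g 0‖ₑ +
      ∫⁻ z, ‖deriv f z * deriv g z + f z * deriv (deriv g) z‖ₑ ∂areaMeasure := by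
  have h0 : volterra g f 0 = 0 := by simp [volterra]
  rw [b1Norm, h0, (hasDerivAt_volterra hf hg zero_mem_disc).deriv, enorm_zero, zero_add]
  congr 1
  refine lintegral_congr_ae ?_
  filter_upwards [ae_mem_disc] with z hz
  have hz' := isOpen_disc.mem_nhds hz
  have h1 : deriv (volterra g f) =ᶠ[𝓝 z] fun w => f w * deriv g w := by
    filter_upwards [hz'] with w hw using (hasDerivAt_volterra hf hg hw).deriv
  have h2 := (hf.differentiableAt hz').hasDerivAt.mul
    ((differentiableOn_deriv hg).differentiableAt hz').hasDerivAt
  rw [h1.deriv_eq]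
  exact congrArg enorm h2.deriv

theorem b1Norm_sub_apply_zero (g : ℂ → ℂ) :
    b1Norm (fun z => g z - g 0) =
      ‖deriv g 0‖ₑ + ∫⁻ z, ‖deriv (deriv g) z‖ₑ ∂areaMeasure := by
  have h : deriv (fun z => g z - g 0) = deriv g := by ext z; simp
  simp [b1Norm, h]

theorem b1Norm_lt_top_iff (g : ℂ → ℂ) : b1Norm g < ∞ ↔ b1Norm (fun z => g z - g 0) < ∞ := by
  rw [b1Norm_sub_apply_zero, b1Norm, add_assoc]
  simp [ENNReal.add_lt_top]

theorem b1Norm_one : b1Norm (fun _ => 1) = 1 := by simp [b1Norm]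

theorem memB1_one : MemB1 (fun _ => 1) :=
  ⟨differentiableOn_const _, by rw [b1Norm_one]; exact ENNReal.one_lt_top⟩

theorem b1Norm_volterra_one {g : ℂ → ℂ} (hg : DifferentiableOn ℂ g disc) :
    b1Norm (volterra g fun _ => 1) = b1Norm fun z => g z - g 0 := by
  rw [b1Norm_volterra memB1_one.1 hg, b1Norm_sub_apply_zero]
  simp

theorem b1Norm_volterra_le {f g : ℂ → ℂ} (hf : MemB1 f) (hg : MemB1 g) :
    b1Norm (volterra g f) ≤
      ENNReal.ofReal (1 + Real.pi) * b1Norm (fun z => g z - g 0) * b1Norm f := by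
  rw [b1Norm_volterra hf.1 hg.1, b1Norm_sub_apply_zero]
  refine (enorm_volterra_bound hf hg).trans ?_
  gcongr
  rw [← ENNReal.ofReal_ofNat 4]
  exact ENNReal.ofReal_le_ofReal (by linarith [Real.pi_gt_three])

end Besov

theorem theorem1 (g : ℂ → ℂ) (hg : DifferentiableOn ℂ g Besov.disc) :
    (Besov.BoundedOnB1 (Besov.volterra g) ↔ Besov.MemB1 g) ∧
    Besov.b1Norm (fun z => g z - g 0) ≤ Besov.opNormB1 (Besov.volterra g) ∧
    Besov.opNormB1 (Besov.volterra g) ≤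
      ENNReal.ofReal (1 + Real.pi) * Besov.b1Norm (fun z => g z - g 0) := by
  refine ⟨⟨fun h => ⟨hg, ?_⟩, fun h => ?_⟩, ?_, ?_⟩
  · rw [Besov.b1Norm_lt_top_iff, ← Besov.b1Norm_volterra_one hg]
    exact (h.1 _ Besov.memB1_one).2
  · have hC : ENNReal.ofReal (1 + Real.pi) * Besov.b1Norm (fun z => g z - g 0) < ∞ :=
      ENNReal.mul_lt_top ENNReal.ofReal_lt_top ((Besov.b1Norm_lt_top_iff g).1 h.2)
    refine ⟨fun f hf => ⟨fun z hz => ?_, ?_⟩,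
      (ENNReal.ofReal (1 + Real.pi) * Besov.b1Norm (fun z => g z - g 0)).toNNReal, fun f hf => ?_⟩
    · exact (Besov.hasDerivAt_volterra hf.1 hg hz).differentiableAt.differentiableWithinAt
    · exact (Besov.b1Norm_volterra_le hf h).trans_lt (ENNReal.mul_lt_top hC hf.2)
    · rw [ENNReal.coe_toNNReal hC.ne]
      exact Besov.b1Norm_volterra_le hf h
  · rw [← Besov.b1Norm_volterra_one hg]
    exact le_iSup₂_of_le _ Besov.memB1_one (le_iSup_of_le Besov.b1Norm_one.le le_rfl)
  · by_cases h : Besov.MemB1 g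
    · refine iSup₂_le fun f hf => iSup_le fun hf1 => (Besov.b1Norm_volterra_le hf h).trans ?_
      exact mul_le_of_le_one_right' hf1
    · have htop : Besov.b1Norm (fun z => g z - g 0) = ∞ := by
        by_contra hne
        exact h ⟨hg, (Besov.b1Norm_lt_top_iff g).2 (lt_top_iff_ne_top.2 hne)⟩
      have hpi : ENNReal.ofReal (1 + Real.pi) ≠ 0 := by
        rw [Ne, ENNReal.ofReal_eq_zero, not_le]
        positivity
      rw [htop, ENNReal.mul_top hpi]
      exact le_top
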